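/- Let $\mathbb N=\{0,1,2,\dots\}$ and let $p=\{p_x\}_{x\in\mathbb N}$ be a probability mass function with $p_x\ge p_{x+1}$ for all $x$. Let $X_1,X_2,\dots$ be i.i.d. $\mathbb N$-valued random variables with mass function $p$, and let $\widehat p_{n,x}=n^{-1}\#\{i\le n: X_i=x\}$ be the empirical mass function of $X_1,\dots,X_n$. For a finite real vector $w=(w_0,\dots,w_k)$, let $\mathrm{rear}(w)$ be the vector with the same entries sorted in decreasing order. Let $\mathrm{gren}(w)$ be the vector of the $k+1$ slopes, on $[x-1,x]$ for $x=0,\dots,k$, of the least concave majorant of the points $\bigl(j,\sum_{i=0}^{j}w_i\bigr)$, $j=-1,0,\dots,k$, where the empty sum is $0$. Let $\widehat p_n^R=\mathrm{rear}(\widehat p_n)$ and $\widehat p_n^G=\mathrm{gren}(\widehat p_n)$, where $\widehat p_n$ is regarded as the vector $(\widehat p_{n,0},\dots,\widehat p_{n,\max\{X_1,\dots,X_n\}})$ and the results are extended by zero to all of $\mathbb N$. Put $$Y^R_{n,x}=\sqrt n\,(\widehat p^R_{n,x}-p_x),\qquad Y^G_{n,x}=\sqrt n\,(\widehat p^G_{n,x}-p_x).$$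 Let $Y=\{Y_x\}_{x\in\mathbb N}$ be a Gaussian process with mean zero and covariance $\mathrm{Cov}(Y_x,Y_z)=p_x\delta_{x,z}-p_xp_z$ (such a process takes values in $\ell_2$ almost surely). For a sequence $q$ and $r\le s$, write $q^{(r,s)}=(q_r,\dots,q_s)$, regarded as a vector of length $s-r+1$. Suppose that $r,s\in\mathbb N$ satisfy $s-r\ge1$ and $p_{r-1}>p_r=\cdots=p_s>p_{s+1}$, where the condition $p_{r-1}>p_r$ is void if $r=0$. Then, as $n\to\infty$, in the sense of convergence in distribution of random vectors in $\mathbb R^{s-r+1}$, $$(Y_n^R)^{(r,s)}\to_d \mathrm{rear}\bigl(Y^{(r,s)}\bigr),\qquad (Y_n^G)^{(r,s)}\to_d \mathrm{gren}\bigl(Y^{(r,s)}\bigr).$$ -/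

import Mathlib

open MeasureTheory ProbabilityTheory Filter Topology

noncomputable section

/-- The entries of the vector `w`, sorted in decreasing order: `Tuple.sort w` is a permutation that
sorts `w` increasingly, and `Fin.rev` reverses the order. -/
def rear {m : ℕ} (w : Fin m → ℝ) : Fin m → ℝ :=
  fun i => w (Tuple.sort w (Fin.rev i))

/-- The points `(j, ∑_{i ≤ j} w_i)` for `j = -1, 0, …, m - 1` (with the empty sum `0` at `j = -1`).
They are parametrised by `l = j + 1 ∈ {0, …, m}`. -/
def cumulativePoints {m : ℕ} (w : Fin m → ℝ) : Set (ℝ × ℝ) :=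
  Set.range fun l : Fin (m + 1) =>
    ((l : ℝ) - 1, ∑ i with Fin.val i < Fin.val l, w i)

/-- The least concave majorant, on the set `I`, of a set `A` of points of the plane: the pointwise
infimum of all functions that are concave on `I` and lie on or above each point of `A`. -/
def leastConcaveMajorant (I : Set ℝ) (A : Set (ℝ × ℝ)) (t : ℝ) : ℝ :=
  sInf {y | ∃ g : ℝ → ℝ, ConcaveOn ℝ I g ∧ (∀ a ∈ A, a.2 ≤ g a.1) ∧ y = g t}

/-- The vector of slopes of the least concave majorant of the points `(j, ∑_{i ≤ j} w_i)`,
`j = -1, …, m - 1`; the entry at `x` is the slope on `[x - 1, x]`. -/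
def gren {m : ℕ} (w : Fin m → ℝ) : Fin m → ℝ := fun x =>
  leastConcaveMajorant (Set.Icc (-1) ((m : ℝ) - 1)) (cumulativePoints w) (x : ℝ) -
    leastConcaveMajorant (Set.Icc (-1) ((m : ℝ) - 1)) (cumulativePoints w) ((x : ℝ) - 1)

/-- The block `(q_r, …, q_s)` of a sequence `q` (for `r ≤ s`). -/
def block (r s : ℕ) (q : ℕ → ℝ) : Fin (s - r + 1) → ℝ := fun i => q (r + i)

/-- A finite vector, continued by zeros to a sequence. -/
def zeroExtend {m : ℕ} (w : Fin m → ℝ) : ℕ → ℝ :=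
  fun x => if h : x < m then w ⟨x, h⟩ else 0

variable {Ω : Type*}

/-- The empirical mass function of the first `n` observations. -/
def empiricalMass (X : ℕ → Ω → ℕ) (n : ℕ) (ω : Ω) : ℕ → ℝ :=
  fun x => (n : ℝ)⁻¹ * ∑ i ∈ Finset.range n, if X i ω = x then 1 else 0

/-- The largest of the first `n` observations. -/
def sampleMax (X : ℕ → Ω → ℕ) (n : ℕ) (ω : Ω) : ℕ :=
  (Finset.range n).sup fun i => X i ω

/-- The empirical mass function as a vector, indexed by `{0, …, sampleMax X n ω}`; it vanishes
outside this set. -/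
def empiricalVector (X : ℕ → Ω → ℕ) (n : ℕ) (ω : Ω) : Fin (sampleMax X n ω + 1) → ℝ :=
  fun x => empiricalMass X n ω x

/-- The rearrangement estimator. -/
def rearrangementEstimator (X : ℕ → Ω → ℕ) (n : ℕ) (ω : Ω) : ℕ → ℝ :=
  zeroExtend (rear (empiricalVector X n ω))

/-- The Grenander estimator (maximum likelihood estimator of a decreasing mass function). -/
def grenanderEstimator (X : ℕ → Ω → ℕ) (n : ℕ) (ω : Ω) : ℕ → ℝ :=
  zeroExtend (gren (empiricalVector X n ω))

/-- The fluctuations `√n (p̂ - p)` of an estimate `phat` of `p` from `n` observations. -/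
def fluctuation (p : PMF ℕ) (n : ℕ) (phat : ℕ → ℝ) : ℕ → ℝ :=
  fun x => √(n : ℝ) * (phat x - (p x).toReal)

/-- `Y` is a centred Gaussian process with `Cov(Y_x, Y_z) = p_x δ_{x,z} - p_x p_z`. Since
`∑ E[Y_x²] = ∑ p_x (1 - p_x) < ∞`, such a process almost surely takes values in `ℓ²`. -/
structure IsLimitProcess (p : PMF ℕ) {mΩ : MeasurableSpace Ω} (Y : ℕ → Ω → ℝ) (P : Measure Ω) :
    Prop where
  isGaussianProcess : IsGaussianProcess Y P
  mean_zero : ∀ x, ∫ ω, Y x ω ∂P = 0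
  covariance_eq : ∀ x z, cov[Y x, Y z; P] =
    (if x = z then (p x).toReal else 0) - (p x).toReal * (p z).toReal

end

/-! Sorting and taking slopes of the least concave majorant share three properties, collected in
`IsIsotonization`: both are continuous, both commute with `w ↦ a w + c` for `a > 0`, and both are
local. Locality means that if the entries before a block are at least `c₂`, those in it lie in `[c₁,
c₂]`, and those after it are at most `c₁`, then the output on the block depends on the block alone.

By the strong law, almost surely the empirical mass function is eventually separated in this way
around `{r, …, s}` (`exists_eventually_separated`). As `p` is constant there, centring and scaling
act on the block as one affine map. Hence almost surely, for all large `n`, the fluctuations of the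
estimator on the block equal the functional applied to the fluctuations of the empirical masses on
the block (`fluctuation_eq`). The latter converge in law by the finite-dimensional central limit
theorem and continuous mapping, and a Slutsky argument transfers the limit.

The hard point is locality for `gren` (`grenMajorant_eq_grenMajorant_block`): a line supporting the
block's majorant whose slope lies in `[c₁, c₂]` also dominates the partial sums outside the block.
-/

/-- A concave function on a set of reals has a supergradient at each point which is neither the
least nor the greatest element of the set. -/
theorem ConcaveOn.exists_supergradient {J : Set ℝ} {h : ℝ → ℝ} (hh : ConcaveOn ℝ J h) {u a b : ℝ}
    (hu : u ∈ J) (ha : a ∈ J) (hb : b ∈ J) (hau : a < u) (hub : u < b) :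
    ∃ c : ℝ, ∀ t ∈ J, h t ≤ h u + c * (t - u) := by
  -- The supergradient is the supremum of the chord slopes to the right of `u`. By concavity every
  -- chord slope on the left bounds them; `b` makes the set nonempty and `a` bounds it above.
  set A : Set ℝ := {y | ∃ t ∈ J, u < t ∧ y = (h t - h u) / (t - u)} with hA
  have hle : ∀ t ∈ J, t < u → ∀ y ∈ A, y ≤ (h u - h t) / (u - t) := by
    rintro t ht htu y ⟨z, hz, huz, rfl⟩
    exact hh.slope_anti_adjacent ht hz htu huz
  have hne : A.Nonempty := ⟨_, b, hb, hub, rfl⟩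
  refine ⟨sSup A, fun t ht => ?_⟩
  rcases lt_trichotomy t u with htu | rfl | htu
  · have h1 := csSup_le hne (hle t ht htu)
    rw [le_div_iff₀ (by linarith)] at h1
    linarith
  · simp
  · have h1 := le_csSup ⟨_, hle a ha hau⟩ (show (h t - h u) / (t - u) ∈ A from ⟨t, ht, htu, rfl⟩)
    rw [div_le_iff₀ (by linarith)] at h1
    linarith

/-! ### Sorting: counting, equivariance, continuity, locality. -/

section Rearrangement

theorem antitone_rear {m : ℕ} (w : Fin m → ℝ) : Antitone (rear w) :=
  fun _ _ hij => Tuple.monotone_sort w (Fin.rev_le_rev.2 hij)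

theorem card_lt_rear {m : ℕ} (w : Fin m → ℝ) (c : ℝ) :
    (Finset.univ.filter fun j => c < rear w j).card = (Finset.univ.filter fun j => c < w j).card := by
  refine Finset.card_equiv (Fin.revPerm.trans (Tuple.sort w)) fun j => ?_
  rw [Finset.mem_filter_univ, Finset.mem_filter_univ]
  rfl

/-- The sorted vector is decreasing, so its indices with value above `c` form an initial segment,
and sorting preserves their number. The facts about `rear` below reduce to such counts. -/
theorem lt_rear_iff {m : ℕ} (w : Fin m → ℝ) (i : Fin m) (c : ℝ) :
    c < rear w i ↔ i.val < (Finset.univ.filter fun j => c < w j).card := by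
  rw [← card_lt_rear]
  constructor
  · intro h
    have hsub : Finset.Iic i ⊆ Finset.univ.filter fun j => c < rear w j := by
      intro j hj
      simpa using h.trans_le (antitone_rear w (Finset.mem_Iic.1 hj))
    have := Finset.card_le_card hsub
    rw [Fin.card_Iic] at this
    omega
  · intro h
    by_contra hc
    have hsub : (Finset.univ.filter fun j => c < rear w j) ⊆ Finset.Iio i := by
      intro j hj
      rw [Finset.mem_Iio]
      by_contra hji
      exact hc ((Finset.mem_filter.1 hj).2.trans_le (antitone_rear w (not_lt.1 hji)))
    have := Finset.card_le_card hsub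
    rw [Fin.card_Iio] at this
    omega

theorem rear_mul_add {m : ℕ} (w : Fin m → ℝ) {a : ℝ} (ha : 0 < a) (c : ℝ) (i : Fin m) :
    rear (fun j => a * w j + c) i = a * rear w i + c := by
  refine eq_of_forall_lt_iff fun b => ?_
  have h1 : ∀ x : ℝ, b < a * x + c ↔ (b - c) / a < x := fun x => by
    rw [div_lt_iff₀ ha]
    constructor <;> intro h <;> linarith
  rw [h1, lt_rear_iff, lt_rear_iff]
  simp only [h1]

theorem rear_mono {m : ℕ} {v w : Fin m → ℝ} (h : v ≤ w) : rear v ≤ rear w := by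
  intro i
  refine le_of_forall_lt fun c hc => ?_
  rw [lt_rear_iff] at hc ⊢
  refine hc.trans_le (Finset.card_le_card fun j hj => ?_)
  simp only [Finset.mem_filter, Finset.mem_univ, true_and] at hj ⊢
  exact hj.trans_le (h j)

/-- Monotonicity and equivariance under adding the constant `dist v w` make sorting 1-Lipschitz in
the sup distance. -/
theorem continuous_rear {m : ℕ} : Continuous (rear : (Fin m → ℝ) → Fin m → ℝ) := by
  have key : ∀ v w : Fin m → ℝ, ∀ i, rear v i ≤ rear w i + dist v w := fun v w i => by
    have h := rear_mono (v := v) (w := fun j => 1 * w j + dist v w) (fun j => by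
      have := (le_abs_self _).trans (dist_le_pi_dist v w j)
      linarith) i
    rw [rear_mul_add w one_pos] at h
    linarith
  refine (LipschitzWith.of_dist_le_mul (K := 1) fun v w => ?_).continuous
  rw [NNReal.coe_one, one_mul, dist_pi_le_iff dist_nonneg]
  intro i
  have h1 := key v w i
  have h2 := key w v i
  rw [dist_comm] at h2
  rw [Real.dist_eq, abs_le]
  constructor <;> linarith

/-- If the entries before a block are large, and those after it are small, then sorting the vector
sorts the block. -/
theorem rear_eq_rear_block (q : ℕ → ℝ) {r k d : ℕ} {c₁ c₂ : ℝ}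
    (hleft : ∀ x < r, c₂ ≤ q x) (hblock : ∀ i < k, q (r + i) ∈ Set.Icc c₁ c₂)
    (hright : ∀ j < d, q (r + k + j) ≤ c₁) (i : ℕ) (hi : i < k) :
    rear (fun x : Fin (r + k + d) => q x) ⟨r + i, by omega⟩ =
      rear (fun x : Fin k => q (r + x)) ⟨i, hi⟩ := by
  refine eq_of_forall_lt_iff fun c => ?_
  rw [lt_rear_iff, lt_rear_iff]
  simp only [Finset.card_filter]
  rw [Fin.sum_univ_eq_sum_range (fun x => if c < q x then 1 else 0),
    Fin.sum_univ_eq_sum_range (fun x => if c < q (r + x) then 1 else 0),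
    Finset.sum_range_add, Finset.sum_range_add]
  set A := ∑ x ∈ Finset.range r, if c < q x then 1 else 0 with hA
  set B := ∑ x ∈ Finset.range k, if c < q (r + x) then 1 else 0 with hB
  set D := ∑ x ∈ Finset.range d, if c < q (r + k + x) then 1 else 0 with hD
  have hAr : A ≤ r := by
    rw [hA, ← Finset.card_filter]
    exact (Finset.card_filter_le _ _).trans (by simp)
  -- The claim is now `r + i < A + B + D ↔ i < B`. If `c < c₂` then `A = r`, and either the block is
  -- full (`B = k`) or nothing after it counts (`D = 0`). If `c ≥ c₂` then `B = D = 0` and `A ≤ r`,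
  -- so both sides fail.
  by_cases h2 : c < c₂
  · have hA' : A = r := by
      rw [hA, Finset.sum_congr rfl fun x hx =>
        if_pos (h2.trans_le (hleft x (Finset.mem_range.1 hx)))]
      simp
    by_cases h1 : c < c₁
    · have hB' : B = k := by
        rw [hB, Finset.sum_congr rfl fun x hx =>
          if_pos (h1.trans_le (hblock x (Finset.mem_range.1 hx)).1)]
        simp
      omega
    · have hD' : D = 0 := Finset.sum_eq_zero fun x hx =>
        if_neg (not_lt.2 ((hright x (Finset.mem_range.1 hx)).trans (not_lt.1 h1)))
      omega
  · have hB' : B = 0 := Finset.sum_eq_zero fun x hx =>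
      if_neg (not_lt.2 ((hblock x (Finset.mem_range.1 hx)).2.trans (not_lt.1 h2)))
    have h12 : c₁ ≤ c₂ := (hblock i hi).1.trans (hblock i hi).2
    have hD' : D = 0 := Finset.sum_eq_zero fun x hx =>
      if_neg (not_lt.2 ((hright x (Finset.mem_range.1 hx)).trans (h12.trans (not_lt.1 h2))))
    omega

end Rearrangement

/-! ### Least concave majorants: equivariance, continuity, locality. -/

section Grenander

/-- `g` is a concave majorant of the points with abscissae `-1, …, m - 1` whose ordinates are the
partial sums of `w`. -/
structure IsConcaveMajorant {m : ℕ} (w : Fin m → ℝ) (g : ℝ → ℝ) : Prop where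
  concaveOn : ConcaveOn ℝ (Set.Icc (-1) ((m : ℝ) - 1)) g
  sum_le : ∀ l ≤ m, ∑ i with Fin.val i < l, w i ≤ g ((l : ℝ) - 1)

/-- The least concave majorant of the points with abscissae `-1, …, m - 1` whose ordinates are the
partial sums of `w`. -/
noncomputable def grenMajorant {m : ℕ} (w : Fin m → ℝ) (t : ℝ) : ℝ :=
  leastConcaveMajorant (Set.Icc (-1) ((m : ℝ) - 1)) (cumulativePoints w) t

theorem grenMajorant_eq {m : ℕ} (w : Fin m → ℝ) (t : ℝ) :
    grenMajorant w t = sInf {y | ∃ g : ℝ → ℝ, IsConcaveMajorant w g ∧ y = g t} := by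
  unfold grenMajorant leastConcaveMajorant
  congr 1
  ext y
  constructor
  · rintro ⟨g, hg, hA, rfl⟩
    exact ⟨g, ⟨hg, fun l hl => hA _ ⟨⟨l, by omega⟩, rfl⟩⟩, rfl⟩
  · rintro ⟨g, hg, rfl⟩
    refine ⟨g, hg.concaveOn, ?_, rfl⟩
    rintro _ ⟨l, rfl⟩
    exact hg.sum_le l (by omega)

theorem isConcaveMajorant_line {m : ℕ} {w : Fin m → ℝ} {b c : ℝ}
    (h : ∀ l ≤ m, ∑ i with Fin.val i < l, w i ≤ b + c * ((l : ℝ) - 1)) :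
    IsConcaveMajorant w fun t => b + c * t := by
  refine ⟨⟨convex_Icc _ _, fun x _ y _ α β _ _ hαβ => ?_⟩, h⟩
  simp only [smul_eq_mul]
  have : α * b + β * b = b := by rw [← add_mul, hαβ, one_mul]
  linarith

theorem exists_isConcaveMajorant {m : ℕ} (w : Fin m → ℝ) : ∃ g, IsConcaveMajorant w g := by
  refine ⟨_, isConcaveMajorant_line (b := ∑ i, |w i|) (c := 0) fun l _ => ?_⟩
  rw [zero_mul, add_zero]
  calc ∑ i with Fin.val i < l, w i ≤ ∑ i with Fin.val i < l, |w i| :=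
        Finset.sum_le_sum fun i _ => le_abs_self _
    _ ≤ ∑ i, |w i| := Finset.sum_le_sum_of_subset_of_nonneg (Finset.filter_subset _ _)
        fun i _ _ => abs_nonneg _

/-- A concave function lies above the smaller of its endpoint values. This bounds the set in the
infimum from below, so that `sInf` is a true infimum on the interval. -/
theorem IsConcaveMajorant.min_le {m : ℕ} {w : Fin m → ℝ} {g : ℝ → ℝ} (hg : IsConcaveMajorant w g)
    {t : ℝ} (ht : t ∈ Set.Icc (-1) ((m : ℝ) - 1)) :
    min 0 (∑ i, w i) ≤ g t := by
  have hm : (-1 : ℝ) ≤ (m : ℝ) - 1 := ht.1.trans ht.2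
  have h := hg.concaveOn.ge_on_segment (Set.left_mem_Icc.2 hm) (Set.right_mem_Icc.2 hm)
    (by rwa [segment_eq_Icc hm])
  refine le_trans (min_le_min ?_ ?_) h
  · simpa using hg.sum_le 0 (Nat.zero_le _)
  · simpa using hg.sum_le m le_rfl

theorem grenMajorant_le {m : ℕ} {w : Fin m → ℝ} {g : ℝ → ℝ} (hg : IsConcaveMajorant w g)
    {t : ℝ} (ht : t ∈ Set.Icc (-1) ((m : ℝ) - 1)) : grenMajorant w t ≤ g t := by
  rw [grenMajorant_eq]
  refine csInf_le ⟨min 0 (∑ i, w i), ?_⟩ ⟨g, hg, rfl⟩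
  rintro _ ⟨f, hf, rfl⟩
  exact hf.min_le ht

theorem le_grenMajorant {m : ℕ} {w : Fin m → ℝ} {t y : ℝ}
    (h : ∀ g, IsConcaveMajorant w g → y ≤ g t) : y ≤ grenMajorant w t := by
  rw [grenMajorant_eq]
  obtain ⟨g, hg⟩ := exists_isConcaveMajorant w
  refine le_csInf ⟨_, g, hg, rfl⟩ ?_
  rintro _ ⟨f, hf, rfl⟩
  exact h f hf

/-- A majorant `g` for `w` yields the majorant `a g + c (t + 1) + ε` for `v`; at abscissa `t = l -
1` the factor `t + 1` is the number of summands. Taking `ε = 0` gives affine equivariance, and `a =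
1`, `c = 0` gives the Lipschitz bound. -/
theorem grenMajorant_le_mul_add {m : ℕ} {v w : Fin m → ℝ} {a c ε : ℝ} (ha : 0 < a)
    (h : ∀ l ≤ m, ∑ i with Fin.val i < l, v i ≤ a * (∑ i with Fin.val i < l, w i) + c * l + ε)
    {t : ℝ} (ht : t ∈ Set.Icc (-1) ((m : ℝ) - 1)) :
    grenMajorant v t ≤ a * grenMajorant w t + c * (t + 1) + ε := by
  suffices H : (grenMajorant v t - c * (t + 1) - ε) / a ≤ grenMajorant w t by
    rw [div_le_iff₀ ha] at H
    linarith
  refine le_grenMajorant fun g hg => ?_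
  rw [div_le_iff₀ ha]
  have hmaj : IsConcaveMajorant v fun t => a * g t + (c * (t + 1) + ε) := by
    refine ⟨⟨convex_Icc _ _, fun x hx y hy α β hα hβ hαβ => ?_⟩, fun l hl => ?_⟩
    · have h1 := mul_le_mul_of_nonneg_left (hg.concaveOn.2 hx hy hα hβ hαβ) ha.le
      simp only [smul_eq_mul] at h1 ⊢
      have h2 : α * (c + ε) + β * (c + ε) = c + ε := by rw [← add_mul, hαβ, one_mul]
      linarith
    · have h1 := mul_le_mul_of_nonneg_left (hg.sum_le l hl) ha.le
      have h2 := h l hl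
      simp only [sub_add_cancel]
      linarith
  have := grenMajorant_le hmaj ht
  linarith

theorem grenMajorant_mul_add {m : ℕ} (w : Fin m → ℝ) {a : ℝ} (ha : 0 < a) (c : ℝ)
    {t : ℝ} (ht : t ∈ Set.Icc (-1) ((m : ℝ) - 1)) :
    grenMajorant (fun j => a * w j + c) t = a * grenMajorant w t + c * (t + 1) := by
  have hcard : ∀ l ≤ m, (Finset.univ.filter fun i : Fin m => i.val < l).card = l := fun l hl => by
    rw [Finset.card_filter, Fin.sum_univ_eq_sum_range (fun x => if x < l then 1 else 0),
      ← Finset.card_filter]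
    have : (Finset.range m).filter (· < l) = Finset.range l := by
      ext x
      simp only [Finset.mem_filter, Finset.mem_range]
      omega
    rw [this, Finset.card_range]
  have hsum : ∀ l ≤ m, ∑ i : Fin m with i.val < l, (a * w i + c) =
      a * (∑ i with Fin.val i < l, w i) + c * l := fun l hl => by
    rw [Finset.sum_add_distrib, ← Finset.mul_sum, Finset.sum_const, hcard l hl, nsmul_eq_mul]
    ring
  refine le_antisymm ?_ ?_
  · have := grenMajorant_le_mul_add (ε := 0) (v := fun j => a * w j + c) (w := w) ha
      (fun l hl => by rw [hsum l hl, add_zero]) ht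
    linarith
  -- The reverse inequality is the same bound for the inverse affine map.
  · have := grenMajorant_le_mul_add (ε := 0) (a := a⁻¹) (c := -(a⁻¹ * c)) (v := w)
      (w := fun j => a * w j + c) (inv_pos.2 ha)
      (fun l hl => by
        rw [hsum l hl]
        apply le_of_eq
        field_simp
        ring) ht
    have h2 := mul_le_mul_of_nonneg_left this ha.le
    have h3 : a * (a⁻¹ * grenMajorant (fun j => a * w j + c) t + -(a⁻¹ * c) * (t + 1) + 0) =
      grenMajorant (fun j => a * w j + c) t - c * (t + 1) := by
      field_simp
      ring
    linarith

theorem Fin.cast_mem_Icc {m : ℕ} (x : Fin m) : (x : ℝ) ∈ Set.Icc (-1) ((m : ℝ) - 1) := by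
  have h : ((x : ℕ) : ℝ) + 1 ≤ m := by exact_mod_cast x.2
  constructor <;> linarith [Nat.cast_nonneg (α := ℝ) (x : ℕ)]

theorem Fin.cast_sub_one_mem_Icc {m : ℕ} (x : Fin m) :
    (x : ℝ) - 1 ∈ Set.Icc (-1) ((m : ℝ) - 1) := by
  have h : ((x : ℕ) : ℝ) + 1 ≤ m := by exact_mod_cast x.2
  constructor <;> linarith [Nat.cast_nonneg (α := ℝ) (x : ℕ)]

theorem gren_apply {m : ℕ} (w : Fin m → ℝ) (x : Fin m) :
    gren w x = grenMajorant w x - grenMajorant w ((x : ℝ) - 1) := rfl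

theorem gren_mul_add {m : ℕ} (w : Fin m → ℝ) {a : ℝ} (ha : 0 < a) (c : ℝ) (i : Fin m) :
    gren (fun j => a * w j + c) i = a * gren w i + c := by
  rw [gren_apply, gren_apply, grenMajorant_mul_add w ha c i.cast_mem_Icc,
    grenMajorant_mul_add w ha c i.cast_sub_one_mem_Icc]
  ring

theorem continuous_grenMajorant {m : ℕ} {t : ℝ} (ht : t ∈ Set.Icc (-1) ((m : ℝ) - 1)) :
    Continuous fun w : Fin m → ℝ => grenMajorant w t := by
  have key : ∀ v w : Fin m → ℝ, grenMajorant v t ≤ grenMajorant w t + m * dist v w := by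
    intro v w
    have := grenMajorant_le_mul_add (v := v) (w := w) (a := 1) (c := 0) (ε := m * dist v w) one_pos
      (fun l hl => ?_) ht
    · linarith
    · have h1 : ∑ i with Fin.val i < l, (v i - w i) ≤ ∑ i : Fin m, dist v w :=
        (Finset.sum_le_sum fun i _ => (le_abs_self _).trans (dist_le_pi_dist v w i)).trans
          (Finset.sum_le_sum_of_subset_of_nonneg (Finset.filter_subset _ _)
            fun i _ _ => dist_nonneg)
      rw [Finset.sum_sub_distrib, Finset.sum_const, Finset.card_univ, Fintype.card_fin,
        nsmul_eq_mul] at h1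
      linarith
  refine (LipschitzWith.of_dist_le_mul (K := (m : NNReal)) fun v w => ?_).continuous
  have h1 := key v w
  have h2 := key w v
  rw [dist_comm] at h2
  rw [Real.dist_eq, abs_le, NNReal.coe_natCast]
  constructor <;> linarith

theorem continuous_gren {m : ℕ} : Continuous (gren : (Fin m → ℝ) → Fin m → ℝ) :=
  continuous_pi fun i =>
    (continuous_grenMajorant i.cast_mem_Icc).sub (continuous_grenMajorant i.cast_sub_one_mem_Icc)

theorem sum_filter_val_lt (q : ℕ → ℝ) {m l : ℕ} (hl : l ≤ m) :
    ∑ i : Fin m with i.val < l, q i = ∑ x ∈ Finset.range l, q x := by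
  rw [Finset.sum_filter, Fin.sum_univ_eq_sum_range (fun x => if x < l then q x else 0),
    ← Finset.sum_filter]
  congr 1
  ext x
  simp only [Finset.mem_filter, Finset.mem_range]
  omega

/-- If the entries before a block are large, and those after it are small, then on the block the
least concave majorant is that of the block. -/
theorem grenMajorant_eq_grenMajorant_block (q : ℕ → ℝ) {r k d : ℕ} {c₁ c₂ : ℝ} (h12 : c₁ ≤ c₂)
    (hleft : ∀ x < r, c₂ ≤ q x) (hblock : ∀ i < k, q (r + i) ∈ Set.Icc c₁ c₂)
    (hright : ∀ j < d, q (r + k + j) ≤ c₁) (u : ℕ) (hu : u ≤ k) :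
    grenMajorant (fun x : Fin (r + k + d) => q x) ((r : ℝ) + u - 1) =
      ∑ x ∈ Finset.range r, q x + grenMajorant (fun x : Fin k => q (r + x)) ((u : ℝ) - 1) := by
  have hu' : (u : ℝ) ≤ k := by exact_mod_cast hu
  have hr0 : (0 : ℝ) ≤ r := Nat.cast_nonneg _
  have hu0 : (0 : ℝ) ≤ u := Nat.cast_nonneg _
  have hd0 : (0 : ℝ) ≤ d := Nat.cast_nonneg _
  have htJ : (u : ℝ) - 1 ∈ Set.Icc (-1 : ℝ) ((k : ℝ) - 1) := ⟨by linarith, by linarith⟩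
  have htI : (r : ℝ) + u - 1 ∈ Set.Icc (-1 : ℝ) (((r + k + d : ℕ) : ℝ) - 1) := by
    push_cast
    constructor <;> linarith
  set S : ℕ → ℝ := fun l => ∑ x ∈ Finset.range l, q x with hS
  set T : ℕ → ℝ := fun l => ∑ x ∈ Finset.range l, q (r + x) with hT
  have hST : ∀ l, S (r + l) = S r + T l := fun l => Finset.sum_range_add _ _ _
  have hSl : ∀ l ≤ r, S l ≤ S r - c₂ * ((r : ℝ) - l) := by
    intro l hl
    obtain ⟨e, rfl⟩ := Nat.exists_eq_add_of_le hl
    have h1 : S (l + e) = S l + ∑ x ∈ Finset.range e, q (l + x) := Finset.sum_range_add _ _ _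
    have h2 := Finset.card_nsmul_le_sum (Finset.range e) (fun x => q (l + x)) c₂
      fun x hx => hleft _ (by have := Finset.mem_range.1 hx; omega)
    rw [Finset.card_range, nsmul_eq_mul] at h2
    push_cast
    linarith
  have hSr : ∀ j ≤ d, S (r + k + j) ≤ S r + T k + c₁ * j := by
    intro j hj
    have h1 : S (r + k + j) = S (r + k) + ∑ x ∈ Finset.range j, q (r + k + x) :=
      Finset.sum_range_add _ _ _
    have h2 := Finset.sum_le_card_nsmul (Finset.range j) (fun x => q (r + k + x)) c₁
      fun x hx => hright _ (by have := Finset.mem_range.1 hx; omega)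
    rw [Finset.card_range, nsmul_eq_mul] at h2
    rw [hST] at h1
    linarith
  have hT2 : ∀ l ≤ k, T l ≤ c₂ * l := by
    intro l hl
    have h2 := Finset.sum_le_card_nsmul (Finset.range l) (fun x => q (r + x)) c₂
      fun x hx => (hblock _ (by have := Finset.mem_range.1 hx; omega)).2
    rw [Finset.card_range, nsmul_eq_mul] at h2
    linarith
  have hT1 : ∀ l ≤ k, T l ≤ T k - c₁ * ((k : ℝ) - l) := by
    intro l hl
    obtain ⟨e, rfl⟩ := Nat.exists_eq_add_of_le hl
    have h1 : T (l + e) = T l + ∑ x ∈ Finset.range e, q (r + (l + x)) := Finset.sum_range_add _ _ _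
    have h2 := Finset.card_nsmul_le_sum (Finset.range e) (fun x => q (r + (l + x))) c₁
      fun x hx => (hblock _ (by have := Finset.mem_range.1 hx; omega)).1
    rw [Finset.card_range, nsmul_eq_mul] at h2
    push_cast
    linarith
  refine le_antisymm ?_ ?_
  -- Upper bound: for each concave majorant `h` of the block it suffices to find a line above the
  -- block's partial sums, with slope in `[c₁, c₂]` and height at most `h (u - 1)` at `u - 1`.
  · rw [← sub_le_iff_le_add']
    refine le_grenMajorant fun h hh => ?_
    rw [sub_le_iff_le_add']
    have hhT : ∀ l ≤ k, T l ≤ h ((l : ℝ) - 1) := fun l hl =>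
      (sum_filter_val_lt (fun x => q (r + x)) hl).symm.trans_le (hh.sum_le l hl)
    have hline : ∀ y c : ℝ, (∀ l ≤ r + k + d, S l ≤ y + c * ((l : ℝ) - r - u)) →
        grenMajorant (fun x : Fin (r + k + d) => q x) ((r : ℝ) + u - 1) ≤ y := by
      intro y c hyc
      have := grenMajorant_le (isConcaveMajorant_line (w := fun x : Fin (r + k + d) => q x)
        (b := y - c * ((r : ℝ) + u - 1)) (c := c) fun l hl => by
          rw [sum_filter_val_lt q hl]
          have := hyc l hl
          simp only [hS] at this
          linarith) htI
      linarith
    -- Such a line dominates globally: going left from the block the sums drop at rate at least `c₂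
    -- ≥ c`, going right they grow at rate at most `c₁ ≤ c`.
    have hlines : ∀ y c : ℝ, c ≤ c₂ → c₁ ≤ c → (∀ l ≤ k, T l ≤ y + c * ((l : ℝ) - u)) →
        grenMajorant (fun x : Fin (r + k + d) => q x) ((r : ℝ) + u - 1) ≤ S r + y := by
      intro y c hc2 hc1 hyc
      refine hline _ c fun l hl => ?_
      rcases le_total l r with hlr | hlr
      · have h1 := hSl l hlr
        have h2 := hyc 0 (Nat.zero_le _)
        have h3 : T 0 = 0 := by simp [hT]
        have h4 : (l : ℝ) ≤ r := by exact_mod_cast hlr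
        push_cast at h2
        nlinarith
      · obtain ⟨e, rfl⟩ := Nat.exists_eq_add_of_le hlr
        rcases le_total e k with hek | hek
        · have h2 := hyc e hek
          rw [hST]
          push_cast
          linarith
        · obtain ⟨j, rfl⟩ := Nat.exists_eq_add_of_le hek
          have h1 := hSr j (by omega)
          have h2 := hyc k le_rfl
          have h4 : (0 : ℝ) ≤ j := Nat.cast_nonneg _
          rw [← add_assoc]
          push_cast
          nlinarith
    -- Two explicit candidates are the line of slope `c₂` through the block's left end and the line
    -- of slope `c₁` through its right end. If both pass above `h` at `u - 1`, then `u` is interior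
    -- and a supergradient of `h` exists.
    by_cases hA : c₂ * u ≤ h ((u : ℝ) - 1)
    · refine (hlines (c₂ * u) c₂ le_rfl h12 fun l hl => ?_).trans (by gcongr)
      have := hT2 l hl
      linarith
    by_cases hB : T k - c₁ * ((k : ℝ) - u) ≤ h ((u : ℝ) - 1)
    · refine (hlines _ c₁ h12 le_rfl fun l hl => ?_).trans (add_le_add le_rfl hB)
      have := hT1 l hl
      linarith
    push Not at hA hB
    have hT0 : T 0 = 0 := by simp [hT]
    have hh0 := hhT 0 (Nat.zero_le _)
    have hhk := hhT k le_rfl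
    have hu1 : 0 < u := by
      rcases Nat.eq_zero_or_pos u with rfl | h1
      · push_cast at hA hh0
        linarith
      · exact h1
    have huk : u < k := by
      rcases hu.eq_or_lt with rfl | h1
      · linarith
      · exact h1
    have hu1' : (0 : ℝ) < u := by exact_mod_cast hu1
    have huk' : (u : ℝ) < k := by exact_mod_cast huk
    have hJ0 : (-1 : ℝ) ∈ Set.Icc (-1 : ℝ) ((k : ℝ) - 1) := ⟨le_rfl, by linarith⟩
    have hJk : (k : ℝ) - 1 ∈ Set.Icc (-1 : ℝ) ((k : ℝ) - 1) := ⟨by linarith, le_rfl⟩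
    obtain ⟨c, hc⟩ := hh.concaveOn.exists_supergradient htJ hJ0 hJk (by linarith) (by linarith)
    have hc0 := hc _ hJ0
    have hck := hc _ hJk
    rw [Nat.cast_zero, zero_sub, hT0] at hh0
    -- Comparison with the left end gives `c * u ≤ h (u - 1) < c₂ * u`; the right end likewise
    -- forces `c > c₁`.
    refine hlines _ c ?_ ?_ fun l hl => ?_
    · by_contra! hcc
      nlinarith
    · by_contra! hcc
      nlinarith
    · have hl' : (l : ℝ) ≤ k := by exact_mod_cast hl
      have hl0 : (0 : ℝ) ≤ l := Nat.cast_nonneg _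
      have h1 := hc ((l : ℝ) - 1) ⟨by linarith, by linarith⟩
      have h2 := hhT l hl
      linarith
  -- Lower bound, which needs no separation: a majorant of the whole vector, shifted by `r` and
  -- lowered by `S r`, majorises the block.
  · refine le_grenMajorant fun g hg => ?_
    have hmaj : IsConcaveMajorant (fun x : Fin k => q (r + x))
        fun t => g ((r : ℝ) + t) - S r := by
      refine ⟨?_, fun l hl => ?_⟩
      · have h1 : ConcaveOn ℝ (Set.Icc (-1) ((k : ℝ) - 1)) fun t => g ((r : ℝ) + t) :=
          (hg.concaveOn.translate_right (r : ℝ)).subset (fun t ht => by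
            have h1 := ht.1
            have h2 := ht.2
            simp only [Set.mem_preimage, Set.mem_Icc]
            push_cast
            constructor <;> linarith) (convex_Icc _ _)
        exact h1.add_const (-S r)
      · rw [sum_filter_val_lt (fun x => q (r + x)) hl]
        have h1 := hg.sum_le (r + l) (by omega)
        rw [sum_filter_val_lt q (by omega)] at h1
        have h2 := hST l
        simp only [hS, hT] at h2
        rw [h2] at h1
        push_cast at h1
        rw [add_sub_assoc] at h1
        simp only [hS]
        linarith
    have := grenMajorant_le hmaj htJ
    rw [← add_sub_assoc] at this
    linarith

theorem gren_eq_gren_block (q : ℕ → ℝ) {r k d : ℕ} {c₁ c₂ : ℝ}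
    (hleft : ∀ x < r, c₂ ≤ q x) (hblock : ∀ i < k, q (r + i) ∈ Set.Icc c₁ c₂)
    (hright : ∀ j < d, q (r + k + j) ≤ c₁) (i : ℕ) (hi : i < k) :
    gren (fun x : Fin (r + k + d) => q x) ⟨r + i, by omega⟩ =
      gren (fun x : Fin k => q (r + x)) ⟨i, hi⟩ := by
  have h12 : c₁ ≤ c₂ := (hblock i hi).1.trans (hblock i hi).2
  have h1 := grenMajorant_eq_grenMajorant_block q h12 hleft hblock hright (i + 1) (by omega)
  have h2 := grenMajorant_eq_grenMajorant_block q h12 hleft hblock hright i (by omega)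
  rw [gren_apply, gren_apply]
  push_cast at h1 ⊢
  rw [← add_assoc, add_sub_cancel_right, add_sub_cancel_right] at h1
  linarith

end Grenander

/-! ### Reduction of vector convergence to scalar convergence. -/

theorem charFun_map_euclideanSpace {Ω ι : Type*} [MeasurableSpace Ω] [Fintype ι] {P : Measure Ω}
    {V : Ω → EuclideanSpace ℝ ι} (hV : AEMeasurable V P) (t : EuclideanSpace ℝ ι) :
    charFun (P.map V) t = charFun (P.map fun ω => ∑ i, t i * V ω i) 1 := by
  rw [charFun_apply, charFun_apply, integral_map hV (by fun_prop),
    integral_map (by fun_prop) (by fun_prop)]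
  simp [PiLp.inner_apply]

/-- **Cramér–Wold device**, for random vectors. -/
theorem tendstoInDistribution_of_forall_sum_mul {Ω Ω' ι : Type*} [MeasurableSpace Ω]
    [MeasurableSpace Ω'] [Fintype ι] {P : Measure Ω} [IsProbabilityMeasure P] {P' : Measure Ω'}
    [IsProbabilityMeasure P'] {Z : ℕ → Ω → ι → ℝ} {W : Ω' → ι → ℝ} (hZ : ∀ n, AEMeasurable (Z n) P)
    (hW : AEMeasurable W P')
    (h : ∀ t : ι → ℝ, TendstoInDistribution (fun n ω => ∑ i, t i * Z n ω i) atTop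
      (fun ω => ∑ i, t i * W ω i) (fun _ => P) P') :
    TendstoInDistribution Z atTop W (fun _ => P) P' := by
  -- Characteristic functions need an inner product, hence the detour through `EuclideanSpace`.
  have hL : TendstoInDistribution (fun n ω => WithLp.toLp 2 (Z n ω)) atTop
      (fun ω => WithLp.toLp 2 (W ω)) (fun _ => P) P' := by
    refine ⟨fun n => by fun_prop, by fun_prop, ?_⟩
    refine (ProbabilityMeasure.tendsto_iff_tendsto_charFun (E := EuclideanSpace ℝ ι)).2 fun t => ?_
    have := ProbabilityMeasure.tendsto_iff_tendsto_charFun.1 (h t).tendsto 1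
    simp only [ProbabilityMeasure.coe_mk] at this ⊢
    rw [charFun_map_euclideanSpace (by fun_prop)]
    refine this.congr fun n => ?_
    rw [charFun_map_euclideanSpace (by fun_prop)]
  exact hL.continuous_comp (g := fun x => WithLp.ofLp x) (PiLp.continuous_ofLp 2 _)

/-! ### Limit theorems for the empirical mass function. -/

section Empirical

theorem aestronglyMeasurable_comp_nat [MeasurableSpace Ω] {P : Measure Ω} {X : Ω → ℕ}
    (hX : AEMeasurable X P) (f : ℕ → ℝ) : AEStronglyMeasurable (fun ω => f (X ω)) P :=
  ((measurable_of_countable f).comp_aemeasurable hX).aestronglyMeasurable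

theorem memLp_indicator_nat [MeasurableSpace Ω] {P : Measure Ω} [IsProbabilityMeasure P]
    {X : Ω → ℕ} (hX : AEMeasurable X P) (x : ℕ) (q : ENNReal) :
    MemLp (fun ω => if X ω = x then (1 : ℝ) else 0) q P := by
  refine MemLp.of_bound (aestronglyMeasurable_comp_nat hX fun y => if y = x then (1 : ℝ) else 0) 1
    (ae_of_all _ fun ω => ?_)
  split_ifs <;> simp

theorem integral_indicator_nat [MeasurableSpace Ω] {P : Measure Ω} {p : PMF ℕ}
    {X : Ω → ℕ} (hX : HasLaw X p.toMeasure P) (x : ℕ) :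
    ∫ ω, (if X ω = x then (1 : ℝ) else 0) ∂P = (p x).toReal := by
  have h := hX.integral_comp (f := fun y => if y = x then (1 : ℝ) else 0)
    (measurable_of_countable _).aestronglyMeasurable
  have h2 : (fun y => if y = x then (1 : ℝ) else 0) = Set.indicator {x} 1 := by
    ext y
    simp [Set.indicator_apply]
  refine h.trans ?_
  rw [h2, integral_indicator_one (measurableSet_singleton x), Measure.real,
    p.toMeasure_apply_singleton x (measurableSet_singleton x)]

theorem covariance_indicator_nat [MeasurableSpace Ω] {P : Measure Ω} [IsProbabilityMeasure P]
    {p : PMF ℕ} {X : Ω → ℕ} (hX : HasLaw X p.toMeasure P) (x z : ℕ) :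
    cov[fun ω => if X ω = x then (1 : ℝ) else 0, fun ω => if X ω = z then (1 : ℝ) else 0; P] =
      (if x = z then (p x).toReal else 0) - (p x).toReal * (p z).toReal := by
  rw [covariance_eq_sub (memLp_indicator_nat hX.aemeasurable x 2)
    (memLp_indicator_nat hX.aemeasurable z 2), integral_indicator_nat hX, integral_indicator_nat hX]
  congr 1
  split_ifs with h
  · subst h
    rw [← integral_indicator_nat hX x]
    congr 1
    ext ω
    simp
  · rw [← integral_zero Ω ℝ (μ := P)]
    congr 1
    ext ω
    simp only [Pi.mul_apply]
    split_ifs with h1 h2 <;> simp_all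

/-- This is the normalised form required by the scalar central limit theorem, with summands `∑ i, t
i * 1{X j = a i}`. -/
theorem sum_fluctuation_empiricalMass (p : PMF ℕ) (X : ℕ → Ω → ℕ) (n : ℕ) (ω : Ω)
    {k : ℕ} (a : Fin k → ℕ) (t : Fin k → ℝ) :
    ∑ i, t i * fluctuation p n (empiricalMass X n ω) (a i) =
      (√n)⁻¹ * (∑ j ∈ Finset.range n, ∑ i, t i * (if X j ω = a i then (1 : ℝ) else 0) -
        n * ∑ i, t i * (p (a i)).toReal) := by
  rw [Finset.sum_comm, Finset.mul_sum, ← Finset.sum_sub_distrib, Finset.mul_sum]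
  refine Finset.sum_congr rfl fun i _ => ?_
  rw [← Finset.mul_sum]
  unfold fluctuation empiricalMass
  rcases Nat.eq_zero_or_pos n with rfl | hn
  · simp
  have hn' : (0 : ℝ) < n := by exact_mod_cast hn
  have h1 : √(n : ℝ) ≠ 0 := (Real.sqrt_pos.2 hn').ne'
  have h2 : (n : ℝ) = √n * √n := (Real.mul_self_sqrt hn'.le).symm
  generalize ∑ j ∈ Finset.range n, (if X j ω = a i then (1 : ℝ) else 0) = S
  set w := √(n : ℝ)
  rw [h2]
  field_simp

variable {Ω' : Type*} [MeasurableSpace Ω] [MeasurableSpace Ω'] {P : Measure Ω}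
  [IsProbabilityMeasure P] {P' : Measure Ω'} [IsProbabilityMeasure P'] {p : PMF ℕ}
  {X : ℕ → Ω → ℕ} {Y : ℕ → Ω' → ℝ}

theorem aemeasurable_empiricalMass (hlaw : ∀ i, HasLaw (X i) p.toMeasure P) (n x : ℕ) :
    AEMeasurable (fun ω => empiricalMass X n ω x) P :=
  (Finset.aemeasurable_fun_sum _ fun i _ =>
    (memLp_indicator_nat (hlaw i).aemeasurable x 2).aemeasurable).const_mul _

/-- The covariance of `Y` is that of the indicators `1{X 0 = x}`. Keeping `v` free lets it be the
variance of one summand, so the scalar limit is identified with `∑ i, t i * Y (a i)`. -/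
theorem IsLimitProcess.hasLaw_sum (hY : IsLimitProcess p Y P') {k : ℕ} (a : Fin k → ℕ)
    (t : Fin k → ℝ) (v : ℝ) (hv : v = ∑ i, ∑ j, t i * (t j *
      ((if a i = a j then (p (a i)).toReal else 0) - (p (a i)).toReal * (p (a j)).toReal))) :
    HasLaw (fun ω => ∑ i, t i * Y (a i) ω) (gaussianReal 0 v.toNNReal) P' := by
  have hY2 : ∀ x, MemLp (Y x) 2 P' := fun x => (hY.isGaussianProcess.hasGaussianLaw_eval x).memLp_two
  have hG : HasGaussianLaw (fun ω => ∑ i, t i * Y (a i) ω) P' := by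
    have h := ((hY.isGaussianProcess.comp_right a).smul t).hasGaussianLaw_fun_sum
      (I := Finset.univ)
    simpa using h
  have hmean : ∫ ω, ∑ i, t i * Y (a i) ω ∂P' = 0 := by
    rw [integral_finsetSum _ fun i _ => ((hY2 (a i)).integrable one_le_two).const_mul _]
    exact Finset.sum_eq_zero fun i _ => by rw [integral_const_mul, hY.mean_zero, mul_zero]
  refine ⟨hG.aemeasurable, ?_⟩
  rw [hG.map_eq_gaussianReal, hmean, variance_fun_sum fun i => (hY2 (a i)).const_mul (t i), hv]
  simp_rw [covariance_const_mul_left, covariance_const_mul_right, hY.covariance_eq]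

/-- Central limit theorem for finitely many coordinates of the empirical mass function. -/
theorem tendstoInDistribution_empiricalMass (hlaw : ∀ i, HasLaw (X i) p.toMeasure P)
    (hindep : iIndepFun X P) (hY : IsLimitProcess p Y P') {k : ℕ} (a : Fin k → ℕ) :
    TendstoInDistribution (fun n ω i => fluctuation p n (empiricalMass X n ω) (a i)) atTop
      (fun ω i => Y (a i) ω) (fun _ => P) P' := by
  refine tendstoInDistribution_of_forall_sum_mul (fun n => ?_) ?_ fun t => ?_
  · exact aemeasurable_pi_lambda _ fun i =>
      ((aemeasurable_empiricalMass hlaw n (a i)).sub_const _).const_mul _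
  · exact aemeasurable_pi_lambda _ fun i => hY.isGaussianProcess.aemeasurable (a i)
  · set f : ℕ → ℝ := fun y => ∑ i, t i * (if y = a i then (1 : ℝ) else 0) with hf
    have hm : ∀ i, MemLp (fun ω => t i * (if X 0 ω = a i then (1 : ℝ) else 0)) 2 P := fun i =>
      (memLp_indicator_nat (hlaw 0).aemeasurable (a i) 2).const_mul (t i)
    have hvar : Var[fun ω => f (X 0 ω); P] = ∑ i, ∑ j, t i * (t j *
      ((if a i = a j then (p (a i)).toReal else 0) - (p (a i)).toReal * (p (a j)).toReal)) := by
      rw [hf, variance_fun_sum hm]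
      simp_rw [covariance_const_mul_left, covariance_const_mul_right,
        covariance_indicator_nat (hlaw 0)]
    have hmean : ∫ ω, f (X 0 ω) ∂P = ∑ i, t i * (p (a i)).toReal := by
      rw [hf, integral_finsetSum _ fun i _ => (hm i).integrable one_le_two]
      exact Finset.sum_congr rfl fun i _ => by
        rw [integral_const_mul, integral_indicator_nat (hlaw 0)]
    have h := tendstoInDistribution_inv_sqrt_mul_sum_sub (X := fun i ω => f (X i ω))
      (hY.hasLaw_sum a t _ hvar) (memLp_finsetSum _ fun i _ => hm i)
      (hindep.comp (fun _ => f) fun _ => measurable_of_countable _)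
      fun i => (IdentDistrib.mk (hlaw i).aemeasurable (hlaw 0).aemeasurable
        ((hlaw i).map_eq.trans (hlaw 0).map_eq.symm)).comp (measurable_of_countable f)
    rw [hmean] at h
    simp_rw [sum_fluctuation_empiricalMass]
    exact h

theorem ae_tendsto_empiricalMass (hlaw : ∀ i, HasLaw (X i) p.toMeasure P)
    (hindep : iIndepFun X P) :
    ∀ᵐ ω ∂P, ∀ x, Tendsto (fun n => empiricalMass X n ω x) atTop (𝓝 (p x).toReal) := by
  refine ae_all_iff.2 fun x => ?_
  have hmeas : Measurable fun y : ℕ => if y = x then (1 : ℝ) else 0 := measurable_of_countable _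
  have h := strong_law_ae_real (μ := P) (fun i ω => if X i ω = x then (1 : ℝ) else 0)
    ((memLp_indicator_nat (hlaw 0).aemeasurable x 2).integrable one_le_two)
    (fun i j hij => (hindep.indepFun hij).comp hmeas hmeas)
    fun i => (IdentDistrib.mk (hlaw i).aemeasurable (hlaw 0).aemeasurable
        ((hlaw i).map_eq.trans (hlaw 0).map_eq.symm)).comp hmeas
  filter_upwards [h] with ω hω
  rw [integral_indicator_nat (hlaw 0)] at hω
  refine hω.congr fun n => ?_
  rw [div_eq_inv_mul]
  rfl

end Empirical

/-! ### Separation of the flat stretch. -/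

/-- Let `f` be a decreasing mass function with `{r, …, s}` as a maximal flat stretch. Functions of
total mass at most one that converge pointwise to `f` are eventually separated by two levels into the parts
before, on, and after `{r, …, s}`. -/
theorem exists_eventually_separated {f : ℕ → ℝ} (hanti : Antitone f) (hpos : ∀ x, 0 ≤ f x)
    (hsum : HasSum f 1) {r s : ℕ} (hflat : ∀ x ∈ Set.Icc r s, f x = f r) (hrs : r ≤ s)
    (hleft : ∀ x, x + 1 = r → f r < f x) (hright : f (s + 1) < f s) :
    ∃ c₁ c₂ : ℝ, 0 < c₁ ∧ ∀ q : ℕ → ℕ → ℝ, (∀ n, ∀ F : Finset ℕ, ∑ x ∈ F, q n x ≤ 1) →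
      (∀ x, Tendsto (fun n => q n x) atTop (𝓝 (f x))) →
      ∀ᶠ n in atTop, (∀ x < r, c₂ ≤ q n x) ∧ (∀ x ∈ Set.Icc r s, q n x ∈ Set.Icc c₁ c₂) ∧
        ∀ x, s < x → q n x ≤ c₁ := by
  obtain ⟨c₁, hc1, hc1'⟩ := exists_between hright
  obtain ⟨c₂, hc2, hc2'⟩ : ∃ c₂, f r < c₂ ∧ ∀ x < r, c₂ < f x := by
    rcases r with _ | r
    · exact ⟨f 0 + 1, by linarith, by simp⟩
    · obtain ⟨c, h1, h2⟩ := exists_between (hleft r rfl)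
      exact ⟨c, h1, fun x hx => h2.trans_le (hanti (Nat.le_of_lt_succ hx))⟩
  have hc10 : 0 < c₁ := (hpos _).trans_lt hc1
  have hsr : f s = f r := hflat s ⟨hrs, le_rfl⟩
  refine ⟨c₁, c₂, hc10, fun q hq hlim => ?_⟩
  -- Pointwise convergence controls only finitely many `x`. Beyond `M` the bound is uniform: once
  -- more than `1 - c₁` of the mass lies below `M`, no single later entry can exceed `c₁`.
  obtain ⟨M, hM⟩ := ((hsum.tendsto_sum_nat).eventually_const_lt
    (show 1 - c₁ < 1 by linarith)).exists
  have e1 : ∀ᶠ n in atTop, ∀ x ∈ Finset.range r, c₂ ≤ q n x :=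
    (eventually_all_finset _).2 fun x hx =>
      (hlim x).eventually_const_le (hc2' x (Finset.mem_range.1 hx))
  have e2 : ∀ᶠ n in atTop, ∀ x ∈ Finset.Icc r s, q n x ∈ Set.Icc c₁ c₂ :=
    (eventually_all_finset _).2 fun x hx => by
      have hx' := hflat x (Finset.mem_Icc.1 hx)
      exact (hlim x).eventually (Icc_mem_nhds (by linarith) (by linarith))
  have e3 : ∀ᶠ n in atTop, ∀ x ∈ Finset.Ioo s M, q n x ≤ c₁ :=
    (eventually_all_finset _).2 fun x hx =>
      (hlim x).eventually_le_const ((hanti (Finset.mem_Ioo.1 hx).1).trans_lt hc1)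
  have e4 : ∀ᶠ n in atTop, 1 - c₁ < ∑ x ∈ Finset.range M, q n x :=
    (tendsto_finsetSum _ fun x _ => hlim x).eventually_const_lt hM
  filter_upwards [e1, e2, e3, e4] with n h1 h2 h3 h4
  refine ⟨fun x hx => h1 x (Finset.mem_range.2 hx), fun x hx => h2 x (Finset.mem_Icc.2 hx),
    fun x hx => ?_⟩
  rcases lt_or_ge x M with hxM | hxM
  · exact h3 x (Finset.mem_Ioo.2 ⟨hx, hxM⟩)
  · have h5 := hq n (insert x (Finset.range M))
    rw [Finset.sum_insert (by simpa using hxM)] at h5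
    linarith

theorem sum_empiricalMass_le_one (X : ℕ → Ω → ℕ) (n : ℕ) (ω : Ω) (F : Finset ℕ) :
    ∑ x ∈ F, empiricalMass X n ω x ≤ 1 := by
  unfold empiricalMass
  rw [← Finset.mul_sum, Finset.sum_comm]
  have h : ∑ i ∈ Finset.range n, ∑ x ∈ F, (if X i ω = x then (1 : ℝ) else 0) ≤ n := by
    refine (Finset.sum_le_card_nsmul _ _ 1 fun i _ => ?_).trans (by simp)
    rw [Finset.sum_ite_eq]
    split_ifs <;> simp
  refine (mul_le_mul_of_nonneg_left h (by positivity)).trans ?_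
  exact inv_mul_le_one

/-- Ensures that the block lies inside the empirical vector, where the extension by zero plays no
role. -/
theorem le_sampleMax_of_empiricalMass_pos {X : ℕ → Ω → ℕ} {n : ℕ} {ω : Ω} {x : ℕ}
    (h : 0 < empiricalMass X n ω x) : x ≤ sampleMax X n ω := by
  by_contra hx
  refine h.ne' ?_
  unfold empiricalMass
  rw [Finset.sum_eq_zero, mul_zero]
  intro i hi
  refine if_neg fun hix => hx ?_
  rw [← hix]
  exact Finset.le_sup (f := fun i => X i ω) hi

/-! ### The common argument for both estimators. -/

/-- A functional of finite vectors which is continuous and commutes with increasing affine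
transformations of the entries, and whose value on a block depends only on the block, if the entries
before the block are larger, and those after it are smaller. -/
structure IsIsotonization (Ψ : ∀ m, (Fin m → ℝ) → Fin m → ℝ) : Prop where
  continuous : ∀ m, Continuous (Ψ m)
  map_mul_add : ∀ m (w : Fin m → ℝ) (a : ℝ), 0 < a → ∀ c i,
    Ψ m (fun j => a * w j + c) i = a * Ψ m w i + c
  eq_block : ∀ (q : ℕ → ℝ) (r k d : ℕ) (c₁ c₂ : ℝ), (∀ x < r, c₂ ≤ q x) →
    (∀ i < k, q (r + i) ∈ Set.Icc c₁ c₂) → (∀ j < d, q (r + k + j) ≤ c₁) → ∀ i (hi : i < k),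
    Ψ (r + k + d) (fun x => q x) ⟨r + i, by omega⟩ = Ψ k (fun x => q (r + x)) ⟨i, hi⟩

theorem isIsotonization_rear : IsIsotonization fun _ w => rear w where
  continuous _ := continuous_rear
  map_mul_add _ w _ ha c i := rear_mul_add w ha c i
  eq_block q _ _ _ _ _ h1 h2 h3 i hi := rear_eq_rear_block q h1 h2 h3 i hi

theorem isIsotonization_gren : IsIsotonization fun _ w => gren w where
  continuous _ := continuous_gren
  map_mul_add _ w _ ha c i := gren_mul_add w ha c i
  eq_block q _ _ _ _ _ h1 h2 h3 i hi := gren_eq_gren_block q h1 h2 h3 i hi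

namespace IsIsotonization

variable {Ψ : ∀ m, (Fin m → ℝ) → Fin m → ℝ}

theorem zeroExtend_eq_block (hΨ : IsIsotonization Ψ) (q : ℕ → ℝ) {m r s : ℕ} (hrs : r ≤ s)
    (hm : s < m) {c₁ c₂ : ℝ} (h1 : ∀ x < r, c₂ ≤ q x) (h2 : ∀ x ∈ Set.Icc r s, q x ∈ Set.Icc c₁ c₂)
    (h3 : ∀ x, s < x → q x ≤ c₁) (i : Fin (s - r + 1)) :
    zeroExtend (Ψ m fun x => q x) (r + i) = Ψ (s - r + 1) (block r s q) i := by
  obtain ⟨d, rfl⟩ : ∃ d, m = r + (s - r + 1) + d := ⟨m - (s + 1), by omega⟩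
  unfold zeroExtend
  rw [dif_pos (by omega)]
  exact hΨ.eq_block q r (s - r + 1) d c₁ c₂ h1
    (fun j hj => h2 _ ⟨by omega, by omega⟩) (fun j _ => h3 _ (by omega)) i i.2

/-- On the block `p` equals `p r`, so centring and scaling is the single map `w ↦ √n w - √n p_r`,
which `Ψ` respects; locality then discards the rest of the vector. -/
theorem fluctuation_eq (hΨ : IsIsotonization Ψ) {p : PMF ℕ} {X : ℕ → Ω → ℕ} {n : ℕ} (hn : 0 < n)
    {ω : Ω} {r s : ℕ} (hrs : r ≤ s) (hflat : ∀ x ∈ Set.Icc r s, p x = p r) {c₁ c₂ : ℝ} (hc : 0 < c₁)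
    (h1 : ∀ x < r, c₂ ≤ empiricalMass X n ω x)
    (h2 : ∀ x ∈ Set.Icc r s, empiricalMass X n ω x ∈ Set.Icc c₁ c₂)
    (h3 : ∀ x, s < x → empiricalMass X n ω x ≤ c₁) :
    block r s (fluctuation p n (zeroExtend (Ψ _ (empiricalVector X n ω)))) =
      Ψ _ (block r s (fluctuation p n (empiricalMass X n ω))) := by
  have hmax : s < sampleMax X n ω + 1 := Nat.lt_succ_of_le <|
    le_sampleMax_of_empiricalMass_pos (hc.trans_le (h2 s ⟨hrs, le_rfl⟩).1)
  have hp : ∀ i : Fin (s - r + 1), p (r + i) = p r := fun i => hflat _ ⟨by omega, by omega⟩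
  have hsqrt : 0 < √(n : ℝ) := Real.sqrt_pos.2 (by exact_mod_cast hn)
  ext i
  have hloc := hΨ.zeroExtend_eq_block (empiricalMass X n ω) hrs hmax h1 h2 h3 i
  have haff := hΨ.map_mul_add _ (block r s (empiricalMass X n ω)) _ hsqrt
    (-(√(n : ℝ) * (p r).toReal)) i
  have hfl : block r s (fluctuation p n (empiricalMass X n ω)) =
      fun j => √(n : ℝ) * block r s (empiricalMass X n ω) j + -(√(n : ℝ) * (p r).toReal) := by
    ext j
    simp only [block, fluctuation, hp]
    ring
  rw [hfl, haff, ← hloc]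
  simp only [block, fluctuation, hp]
  unfold empiricalVector
  ring

variable {Ω' : Type*} [MeasurableSpace Ω] [MeasurableSpace Ω'] {P : Measure Ω} {P' : Measure Ω'}
  {p : PMF ℕ} {X : ℕ → Ω → ℕ} {Y : ℕ → Ω' → ℝ}

/-- The vector's length varies with `ω`, but everything factors through the first `n` observations,
which take values in a countable discrete space where every function is measurable. -/
theorem aemeasurable_fluctuation (hX : ∀ i, AEMeasurable (X i) P) (r s n : ℕ) :
    AEMeasurable (fun ω => block r s
      (fluctuation p n (zeroExtend (Ψ _ (empiricalVector X n ω))))) P := by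
  set V : Ω → Fin n → ℕ := fun ω i => X i ω with hV
  set Z : Ω → Fin (s - r + 1) → ℝ := fun ω => block r s
      (fluctuation p n (zeroExtend (Ψ _ (empiricalVector X n ω)))) with hZ
  have hfac : Z.FactorsThrough V := by
    intro ω ω' h
    have hXω : ∀ i ∈ Finset.range n, X i ω = X i ω' := fun i hi =>
      congrFun h ⟨i, Finset.mem_range.1 hi⟩
    have h1 : empiricalMass X n ω = empiricalMass X n ω' := by
      ext x
      unfold empiricalMass
      rw [Finset.sum_congr rfl fun i hi => by rw [hXω i hi]]
    have h2 : sampleMax X n ω = sampleMax X n ω' := Finset.sup_congr rfl hXω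
    exact congrArg₂ (fun (m : ℕ) (q : ℕ → ℝ) =>
      block r s (fluctuation p n (zeroExtend (Ψ (m + 1) fun x => q x)))) h2 h1
  have hZV : Z = Function.extend V Z 0 ∘ V := by
    ext1 ω
    exact (hfac.extend_apply 0 ω).symm
  rw [hZV]
  exact (measurable_of_countable _).comp_aemeasurable (aemeasurable_pi_lambda _ fun i => hX i)

theorem tendstoInDistribution_fluctuation [IsProbabilityMeasure P] [IsProbabilityMeasure P']
    (hΨ : IsIsotonization Ψ) (hp : Antitone p)
    (hlaw : ∀ i, HasLaw (X i) p.toMeasure P) (hindep : iIndepFun X P)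
    (hY : IsLimitProcess p Y P') {r s : ℕ} (hrs : r ≤ s)
    (hflat : ∀ x ∈ Set.Icc r s, p x = p r) (hleft : ∀ x, x + 1 = r → p r < p x)
    (hright : p (s + 1) < p s) :
    TendstoInDistribution
      (fun n ω => block r s (fluctuation p n (zeroExtend (Ψ _ (empiricalVector X n ω)))))
      atTop (fun ω => Ψ _ (block r s fun x => Y x ω)) (fun _ => P) P' := by
  have hclt : TendstoInDistribution
      (fun n ω => Ψ (s - r + 1) (block r s (fluctuation p n (empiricalMass X n ω)))) atTop
      (fun ω => Ψ _ (block r s fun x => Y x ω)) (fun _ => P) P' :=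
    (tendstoInDistribution_empiricalMass hlaw hindep hY
      fun i : Fin (s - r + 1) => r + i).continuous_comp (hΨ.continuous (s - r + 1))
  have hmeas := fun n => aemeasurable_fluctuation (p := p) (Ψ := Ψ)
    (fun i => (hlaw i).aemeasurable) r s n
  -- Slutsky: almost surely the difference of the two sequences is eventually exactly zero.
  refine tendstoInDistribution_of_tendstoInMeasure_sub _ _ hclt ?_ hmeas
  have hsum : HasSum (fun x => (p x).toReal) 1 := by
    have h := ENNReal.hasSum_toReal p.tsum_coe_ne_top
    rwa [← ENNReal.tsum_toReal_eq p.apply_ne_top, p.tsum_coe, ENNReal.toReal_one] at h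
  obtain ⟨c₁, c₂, hc, hsep⟩ := exists_eventually_separated (f := fun x => (p x).toReal)
    (fun x y hxy => ENNReal.toReal_mono (p.apply_ne_top x) (hp hxy))
    (fun _ => ENNReal.toReal_nonneg) hsum (fun x hx => by rw [hflat x hx]) hrs
    (fun x hx => (ENNReal.toReal_lt_toReal (p.apply_ne_top _) (p.apply_ne_top _)).2 (hleft x hx))
    ((ENNReal.toReal_lt_toReal (p.apply_ne_top _) (p.apply_ne_top _)).2 hright)
  refine tendstoInMeasure_of_tendsto_ae
    (fun n => ((hmeas n).sub (hclt.forall_aemeasurable n)).aestronglyMeasurable) ?_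
  filter_upwards [ae_tendsto_empiricalMass hlaw hindep] with ω hω
  refine tendsto_const_nhds.congr' ?_
  filter_upwards [hsep (fun n => empiricalMass X n ω) (fun n F => sum_empiricalMass_le_one X n ω F)
    hω, eventually_gt_atTop 0] with n ⟨h1, h2, h3⟩ hn
  simp only [Pi.sub_apply, Pi.zero_apply]
  rw [hΨ.fluctuation_eq hn hrs hflat hc h1 h2 h3, sub_self]

end IsIsotonization

theorem mainTheorem6
    {Ω Ω' : Type*} [MeasurableSpace Ω] [MeasurableSpace Ω']
    (P : Measure Ω) [IsProbabilityMeasure P] (P' : Measure Ω') [IsProbabilityMeasure P']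
    (p : PMF ℕ) (hp : Antitone p)
    (X : ℕ → Ω → ℕ) (hlaw : ∀ i, HasLaw (X i) p.toMeasure P) (hindep : iIndepFun X P)
    (Y : ℕ → Ω' → ℝ) (hY : IsLimitProcess p Y P')
    (r s : ℕ) (hrs : r < s)
    (hflat : ∀ x ∈ Set.Icc r s, p x = p r)
    (hleft : ∀ x, x + 1 = r → p r < p x)
    (hright : p (s + 1) < p s) :
    TendstoInDistribution
        (fun (n : ℕ) ω => block r s (fluctuation p n (rearrangementEstimator X n ω)))
        atTop (fun ω => rear (block r s fun x => Y x ω)) (fun _ => P) P' ∧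
      TendstoInDistribution
        (fun (n : ℕ) ω => block r s (fluctuation p n (grenanderEstimator X n ω)))
        atTop (fun ω => gren (block r s fun x => Y x ω)) (fun _ => P) P' := by
  exact ⟨isIsotonization_rear.tendstoInDistribution_fluctuation hp hlaw hindep hY hrs.le hflat hleft
      hright,
    isIsotonization_gren.tendstoInDistribution_fluctuation hp hlaw hindep hY hrs.le hflat hleft
      hright⟩
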